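/- Let $\mathcal{E}=(\mathcal{A},\mathcal{S})$ be a skeletally small exact category (in the sense of Quillen) with enough projectives; let $\mathcal{P}$ be its subcategory of all projective objects, and assume that $\mathcal{A}$ is weakly idempotent complete (every section has a cokernel). Subcategories are full, and $\rightarrowtail$, $\twoheadrightarrow$ denote inflations and deflations. For a subcategory $\mathcal{T}$ let $\mathsf{Fac}\,\mathcal{T}$ be the class of all $X$ admitting a deflation $T\twoheadrightarrow X$ with $T\in\mathcal{T}$; a morphism $f:X\to T$ is a left $\mathcal{T}$-approximation if $T\in\mathcal{T}$ and every morphism from $X$ to an object of $\mathcal{T}$ factors through $f$; a morphism is admissible if it is a deflation followed by an inflation. Let $\mathcal{T}$ be a $\tau$-rigid subcategory of $\mathcal{E}$, i.e. $\mathcal{T}$ is closed under finite direct sums and direct summands and $\mathrm{Ext}^1_{\mathcal{E}}(\mathcal{T},\mathsf{Fac}\,\mathcal{T})=0$. Assume condition (A): every $P\in\mathcal{P}$ has an admissible left $\mathcal{T}$-approximation $P\to T$. Let $\mathcal{I}$ be the ideal of $\mathcal{P}$ of all morphisms $f$ between projective objects with $\mathrm{Hom}_{\mathcal{E}}(f,T)=0$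 for all $T\in\mathcal{T}$, put $\mathcal{A}_{\mathcal{T}}=\{X\in\mathcal{E} : \mathrm{Hom}_{\mathcal{E}}(f,X)=0 \text{ for all } f\in\mathcal{I}\}$, let $\mathcal{S}_{\mathcal{T}}$ be the class of conflations in $\mathcal{S}$ all of whose three terms lie in $\mathcal{A}_{\mathcal{T}}$, and put $\mathcal{E}_{\mathcal{T}}=(\mathcal{A}_{\mathcal{T}},\mathcal{S}_{\mathcal{T}})$. Then $\mathcal{E}_{\mathcal{T}}$ is an exact category, $\mathcal{T}\subseteq\mathcal{A}_{\mathcal{T}}$, and $\mathcal{T}$ is a partial tilting subcategory of $\mathcal{E}_{\mathcal{T}}$: it is closed under finite direct sums and direct summands, $\mathrm{Ext}^i_{\mathcal{E}_{\mathcal{T}}}(\mathcal{T},\mathcal{T})=0$ for all $i\ge 1$, and $\mathrm{Ext}^2_{\mathcal{E}_{\mathcal{T}}}(T,-)=0$ for every $T\in\mathcal{T}$. If moreover $\mathcal{T}$ is support $\tau$-tilting, i.e. for every $P\in\mathcal{P}$ there is an exact sequence $P\xrightarrow{f}T^0\twoheadrightarrow T^1$ with $T^0,T^1\in\mathcal{T}$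 and $f$ an (admissible) left $\mathcal{T}$-approximation, then $\mathcal{T}$ is a ($1$-)tilting subcategory of $\mathcal{E}_{\mathcal{T}}$: writing $\mathcal{T}^{\perp}=\{Y\in\mathcal{E}_{\mathcal{T}} : \mathrm{Ext}^i_{\mathcal{E}_{\mathcal{T}}}(T,Y)=0 \text{ for all } i\ge 1,\ T\in\mathcal{T}\}$, the exact category $\mathcal{T}^{\perp}$ (with the conflations of $\mathcal{S}_{\mathcal{T}}$ whose terms lie in $\mathcal{T}^{\perp}$) has enough projectives and its projective objects are exactly the objects of $\mathcal{T}$, and for every $X\in\mathcal{E}_{\mathcal{T}}$ there is a conflation $X\rightarrowtail Y_0\twoheadrightarrow Y_1$ in $\mathcal{S}_{\mathcal{T}}$ with $Y_0,Y_1\in\mathcal{T}^{\perp}$. -/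

import Mathlib

open CategoryTheory CategoryTheory.Limits

universe w v u

namespace QuillenExact

variable {C : Type u} [Category.{v} C] [Preadditive C]

/-! ### Exact categories

A candidate exact structure on a preadditive category is a class `S` of short complexes, called
conflations.  A full subcategory is given by an `ObjectProperty`. -/

/-- A morphism is an inflation if it is the first map of a conflation. -/
def IsInflation (S : ObjectProperty (ShortComplex C)) {X Y : C} (i : X ⟶ Y) : Prop :=
  ∃ (Z : C) (p : Y ⟶ Z) (h : i ≫ p = 0), S (ShortComplex.mk i p h)

/-- A morphism is a deflation if it is the second map of a conflation. -/
def IsDeflation (S : ObjectProperty (ShortComplex C)) {Y Z : C} (p : Y ⟶ Z) : Prop :=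
  ∃ (X : C) (i : X ⟶ Y) (h : i ≫ p = 0), S (ShortComplex.mk i p h)

/-- `(C, S)` is an exact category in the sense of Quillen: `C` is additive, `S` is a class of
kernel-cokernel pairs that is closed under isomorphisms, and the axioms `E0`, `E1`, `E2` and their
duals hold. -/
structure IsExactCategory (S : ObjectProperty (ShortComplex C)) : Prop where
  additive : HasFiniteBiproducts C
  iso_closed : S.IsClosedUnderIsomorphisms
  isKernel : ∀ K : ShortComplex C, S K → Nonempty (IsLimit (KernelFork.ofι K.f K.zero))
  isCokernel : ∀ K : ShortComplex C, S K → Nonempty (IsColimit (CokernelCofork.ofπ K.g K.zero))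
  id_inflation : ∀ X : C, IsInflation S (𝟙 X)
  id_deflation : ∀ X : C, IsDeflation S (𝟙 X)
  comp_inflation : ∀ {X Y Z : C} (i : X ⟶ Y) (j : Y ⟶ Z),
    IsInflation S i → IsInflation S j → IsInflation S (i ≫ j)
  comp_deflation : ∀ {X Y Z : C} (p : X ⟶ Y) (q : Y ⟶ Z),
    IsDeflation S p → IsDeflation S q → IsDeflation S (p ≫ q)
  pushout_inflation : ∀ {X Y X' : C} (i : X ⟶ Y) (f : X ⟶ X'), IsInflation S i →
    ∃ (Y' : C) (f' : Y ⟶ Y') (i' : X' ⟶ Y'), IsPushout i f f' i' ∧ IsInflation S i'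
  pullback_deflation : ∀ {Y Z Z' : C} (p : Y ⟶ Z) (f : Z' ⟶ Z), IsDeflation S p →
    ∃ (Y' : C) (f' : Y' ⟶ Y) (p' : Y' ⟶ Z'), IsPullback f' p' p f ∧ IsDeflation S p'

/-- The conflations all of whose three terms lie in the full subcategory `A`, as a class of short
complexes in `A`. -/
def restrict (S : ObjectProperty (ShortComplex C)) (A : ObjectProperty C) :
    ObjectProperty (ShortComplex A.FullSubcategory) :=
  fun K => S (K.map A.ι)

/-- A morphism is admissible if it is a deflation followed by an inflation. -/
def IsAdmissible (S : ObjectProperty (ShortComplex C)) {X Y : C} (f : X ⟶ Y) : Prop :=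
  ∃ (K : C) (d : X ⟶ K) (i : K ⟶ Y), IsDeflation S d ∧ IsInflation S i ∧ d ≫ i = f

/-- `P` is projective if `Hom(P, -)` takes conflations to short exact sequences.  As a conflation
is a kernel pair, only the surjectivity on the right is a condition. -/
def IsProjective (S : ObjectProperty (ShortComplex C)) (P : C) : Prop :=
  ∀ K : ShortComplex C, S K → ∀ f : P ⟶ K.X₃, ∃ g : P ⟶ K.X₂, g ≫ K.g = f

/-- Every object receives a deflation from a projective object. -/
def HasEnoughProjectives (S : ObjectProperty (ShortComplex C)) : Prop :=
  ∀ X : C, ∃ (P : C) (p : P ⟶ X), IsProjective S P ∧ IsDeflation S p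

/-- There are enough projectives, and the projective objects are exactly the objects of `T`. -/
def HasEnoughProjectivesGivenBy (S : ObjectProperty (ShortComplex C)) (T : ObjectProperty C) :
    Prop :=
  HasEnoughProjectives S ∧ ∀ X : C, IsProjective S X ↔ T X

variable (C) in
/-- Every section (split monomorphism) has a cokernel. -/
def WeaklyIdempotentComplete : Prop :=
  ∀ {X Y : C} (s : X ⟶ Y) (r : Y ⟶ X), s ≫ r = 𝟙 X → HasCokernel s

/-! ### Subcategories -/

/-- `Z` is a direct sum of `X` and `Y`. -/
def IsDirectSum (X Y Z : C) : Prop :=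
  ∃ (i : X ⟶ Z) (j : Y ⟶ Z) (p : Z ⟶ X) (q : Z ⟶ Y),
    i ≫ p = 𝟙 X ∧ j ≫ q = 𝟙 Y ∧ i ≫ q = 0 ∧ j ≫ p = 0 ∧ p ≫ i + q ≫ j = 𝟙 Z

/-- `T` is closed under finite direct sums (including the empty one) and direct summands; in
particular it is closed under isomorphisms. -/
structure IsAdditivelyClosed (T : ObjectProperty C) : Prop where
  zero : ∀ Z : C, IsZero Z → T Z
  sum : ∀ X Y Z : C, IsDirectSum X Y Z → T X → T Y → T Z
  summand : ∀ X Y Z : C, IsDirectSum X Y Z → T Z → T X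

/-- The objects `X` that admit a deflation `A ↠ X` with `A` in `T`. -/
def Fac (S : ObjectProperty (ShortComplex C)) (T : ObjectProperty C) : ObjectProperty C :=
  fun X => ∃ (A : C) (p : A ⟶ X), T A ∧ IsDeflation S p

/-- `f : X ⟶ Y` is a left `T`-approximation: `Y` lies in `T`, and every morphism from `X` to an
object of `T` factors through `f`. -/
def IsLeftApproximation (T : ObjectProperty C) {X Y : C} (f : X ⟶ Y) : Prop :=
  T Y ∧ ∀ (Z : C), T Z → ∀ g : X ⟶ Z, ∃ h : Y ⟶ Z, f ≫ h = g

/-! ### Yoneda extension groups -/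

/-- A conflation `X ↣ mid ↠ Z` with prescribed ends. -/
structure Conflation (S : ObjectProperty (ShortComplex C)) (X Z : C) where
  mid : C
  i : X ⟶ mid
  p : mid ⟶ Z
  zero : i ≫ p = 0
  mem : S (ShortComplex.mk i p zero)

/-- `Extension S n X Y` is the type of exact sequences `Y ↣ Z_{n+1} → ⋯ → Z_1 ↠ X` with `n + 1`
middle terms, that is, of `(n+1)`-extensions of `X` by `Y`.  Such a sequence is recorded as the
chain of the conflations from which it is spliced: for `n + 1` middle terms with `n ≥ 1` it is a
conflation `W ↣ Z_1 ↠ X` together with an exact sequence `Y ↣ Z_{n+1} → ⋯ → Z_2 ↠ W`. -/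
def Extension (S : ObjectProperty (ShortComplex C)) : ℕ → C → C → Type (max u v)
  | 0, X, Y => Conflation S Y X
  | n + 1, X, Y => Σ W : C, Conflation S W X × Extension S n W Y

/-- There is a morphism of exact sequences (a commutative ladder) `E ⟶ E'` whose components at the
right and left ends are `a` and `b`. -/
def ExtensionMap (S : ObjectProperty (ShortComplex C)) :
    ∀ (n : ℕ) {X X' Y Y' : C}, Extension S n X Y → Extension S n X' Y' →
      (X ⟶ X') → (Y ⟶ Y') → Prop
  | 0, _, _, _, _, (E : Conflation S _ _), (E' : Conflation S _ _), a, b =>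
      ∃ z : E.mid ⟶ E'.mid, E.i ≫ z = b ≫ E'.i ∧ E.p ≫ a = z ≫ E'.p
  | n + 1, _, _, _, _, ⟨W, E, F⟩, ⟨W', E', F'⟩, a, b =>
      ∃ (c : W ⟶ W') (z : E.mid ⟶ E'.mid),
        E.i ≫ z = c ≫ E'.i ∧ E.p ≫ a = z ≫ E'.p ∧ ExtensionMap S n F F' c b

/-- The underlying set of the extension group `Ext^n(X, Y)` of `(C, S)`: for `n = 0` the
morphisms, for `n ≥ 1` the `n`-extensions modulo the equivalence relation generated by the
morphisms of exact sequences that are the identity at both ends. -/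
def Ext (S : ObjectProperty (ShortComplex C)) : ℕ → C → C → Type (max u v)
  | 0, X, Y => ULift.{max u v} (X ⟶ Y)
  | n + 1, X, Y => Quot (fun E E' : Extension S n X Y => ExtensionMap S n E E' (𝟙 X) (𝟙 Y))

/-- `Ext^n(X, Y) = 0`: an abelian group is zero if and only if it has only one element. -/
def ExtVanishes (S : ObjectProperty (ShortComplex C)) (n : ℕ) (X Y : C) : Prop :=
  Subsingleton (Ext S n X Y)

/-- The projective dimension of `X` is at most `n`: `Ext^{n+1}(X, -) = 0`. -/
def ProjDimLE (S : ObjectProperty (ShortComplex C)) (n : ℕ) (X : C) : Prop :=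
  ∀ Y : C, ExtVanishes S (n + 1) X Y

/-! ### Tilting and support `τ`-tilting subcategories -/

/-- The full subcategory of all `Y` with `Ext^n(X, Y) = 0` for all `n ≥ 1` and all `X` in `T`. -/
def rightPerp (S : ObjectProperty (ShortComplex C)) (T : ObjectProperty C) : ObjectProperty C :=
  fun Y => ∀ n : ℕ, 1 ≤ n → ∀ X : C, T X → ExtVanishes S n X Y

/-- `Cores S n D` consists of the objects `X` for which there is an exact sequence
`X ↣ Y_0 → ⋯ → Y_{n-1} ↠ Y_n` with all `Y_i` in `D`. -/
def Cores (S : ObjectProperty (ShortComplex C)) : ℕ → ObjectProperty C → ObjectProperty C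
  | 0, D => D.isoClosure
  | n + 1, D => fun X => ∃ (Y X' : C) (i : X ⟶ Y) (p : Y ⟶ X') (h : i ≫ p = 0),
      S (ShortComplex.mk i p h) ∧ D Y ∧ Cores S n D X'

/-- `T` is an `n`-tilting subcategory: the exact category `T^⊥` (with the conflations of `S` whose
terms lie in `T^⊥`) has enough projectives, the projectives being exactly the objects of `T`, and
every object has a coresolution of length `n` by objects of `T^⊥`. -/
structure IsNTilting (S : ObjectProperty (ShortComplex C)) (n : ℕ) (T : ObjectProperty C) :
    Prop where
  le_perp : T ≤ rightPerp S T
  enough : HasEnoughProjectivesGivenBy (restrict S (rightPerp S T))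
    (T.inverseImage (rightPerp S T).ι)
  cores : ∀ X : C, Cores S n (rightPerp S T) X

/-- Tilting means `1`-tilting. -/
def IsTilting (S : ObjectProperty (ShortComplex C)) (T : ObjectProperty C) : Prop :=
  IsNTilting S 1 T

/-- `T` is partial tilting: it is additive, closed under direct summands, self-orthogonal, and of
projective dimension at most one. -/
structure IsPartialTilting (S : ObjectProperty (ShortComplex C)) (T : ObjectProperty C) :
    Prop where
  additivelyClosed : IsAdditivelyClosed T
  selfOrthogonal : T ≤ rightPerp S T
  projDim : ∀ X : C, T X → ProjDimLE S 1 X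

/-- `T` is `τ`-rigid: it is additively closed and `Ext^1(T, Fac T) = 0`. -/
structure IsTauRigid (S : ObjectProperty (ShortComplex C)) (T : ObjectProperty C) : Prop where
  additivelyClosed : IsAdditivelyClosed T
  ext_fac : ∀ X Y : C, T X → Fac S T Y → ExtVanishes S 1 X Y

/-- Every projective object `P` has an admissible left `T`-approximation. -/
def ConditionA (S : ObjectProperty (ShortComplex C)) (T : ObjectProperty C) : Prop :=
  ∀ P : C, IsProjective S P →
    ∃ (X : C) (f : P ⟶ X), IsLeftApproximation T f ∧ IsAdmissible S f

/-- `T` is support `τ`-tilting: it is `τ`-rigid, and for every projective object `P` there is an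
exact sequence `P → T⁰ ↠ T¹` with `T⁰, T¹` in `T` whose first map `f` is a left `T`-approximation.
Exactness is spelled out: `f` is a deflation `d : P ↠ K` followed by a kernel `i : K ↣ T⁰` of
`T⁰ ↠ T¹`. -/
structure IsSupportTauTilting (S : ObjectProperty (ShortComplex C)) (T : ObjectProperty C) :
    Prop where
  tauRigid : IsTauRigid S T
  exact_seq : ∀ P : C, IsProjective S P →
    ∃ (K T₀ T₁ : C) (d : P ⟶ K) (i : K ⟶ T₀) (g : T₀ ⟶ T₁) (h : i ≫ g = 0),
      T T₀ ∧ T T₁ ∧ IsDeflation S d ∧ S (ShortComplex.mk i g h) ∧ IsLeftApproximation T (d ≫ i)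

/-! ### The exact category attached to `T` -/

/-- The ideal `I` of the category of projective objects: the morphisms `f : Q ⟶ Q'` between
projective objects such that `Hom(f, X) = 0` for all `X` in `T`. -/
def projIdeal (S : ObjectProperty (ShortComplex C)) (T : ObjectProperty C) :
    MorphismProperty C :=
  fun Q Q' f => IsProjective S Q ∧ IsProjective S Q' ∧
    ∀ X : C, T X → ∀ g : Q' ⟶ X, f ≫ g = 0

/-- The full subcategory of all `X` with `Hom(I, X) = 0`. -/
def annSubcategory (S : ObjectProperty (ShortComplex C)) (T : ObjectProperty C) :
    ObjectProperty C :=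
  fun X => ∀ (Q Q' : C) (f : Q ⟶ Q'), projIdeal S T f → ∀ g : Q' ⟶ X, f ≫ g = 0

/-- The class of conflations of the exact category attached to `T`, whose underlying category is
`(annSubcategory S T).FullSubcategory`: all conflations with three terms in it. -/
def annConflations (S : ObjectProperty (ShortComplex C)) (T : ObjectProperty C) :
    ObjectProperty (ShortComplex (annSubcategory S T).FullSubcategory) :=
  restrict S (annSubcategory S T)

/-- `T`, regarded as a subcategory of `(annSubcategory S T).FullSubcategory`. -/
def inAnn (S : ObjectProperty (ShortComplex C)) (T : ObjectProperty C) :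
    ObjectProperty (annSubcategory S T).FullSubcategory :=
  T.inverseImage (annSubcategory S T).ι

end QuillenExact

/-! Everything rests on one embedding (`embedsInFac_ann`): each `X` in the subcategory attached to
`T` fits into a conflation `X ↣ F ↠ G` with `F` in `Fac T`. Take a projective cover `P ↠ X` and an
approximation `P ↠ K ↣ T₀`. The kernel of `P ↠ K` is covered by a projective whose map to `P` lies
in the ideal, so `P ↠ X` factors through `K`. Weak idempotent completeness makes `K ⟶ X` a
deflation, and pushing `K ↣ T₀ ↠ G` out along it gives the embedding.

Given the embedding, rigidity makes `Ext^1(X, -)` right exact for `X` in `T`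
(`IsTauRigid.liftsConflations`), which kills all higher Yoneda extensions
(`LiftsConflations.extVanishes`). This gives partial tilting. In the support case `G` can be taken
in `T`. Then `T^⊥ = Fac T`, the embedding is the required coresolution, and a pushout covers each
object of `Fac T` by an object of `T` with kernel in `Fac T` (`IsTauRigid.exists_conf_of_fac`). -/

namespace QuillenExact

/-! ### Diagram calculus in an exact category. -/

section Toolbox

variable {C : Type u} [Category.{v} C] [Preadditive C] {S : ObjectProperty (ShortComplex C)}

/-- The pair of composable morphisms `(i, p)` is a conflation. -/
def IsConf (S : ObjectProperty (ShortComplex C)) {X Y Z : C} (i : X ⟶ Y) (p : Y ⟶ Z) : Prop :=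
  ∃ h : i ≫ p = 0, S (ShortComplex.mk i p h)

namespace IsConf

variable {X Y Z : C} {i : X ⟶ Y} {p : Y ⟶ Z}

lemma zero (h : IsConf S i p) : i ≫ p = 0 := h.1

lemma isInflation (h : IsConf S i p) : IsInflation S i := ⟨Z, p, h⟩

lemma isDeflation (h : IsConf S i p) : IsDeflation S p := ⟨X, i, h⟩

lemma exists_lift (hS : IsExactCategory S) (h : IsConf S i p) {W : C} (x : W ⟶ Y)
    (hx : x ≫ p = 0) : ∃ l : W ⟶ X, l ≫ i = x := by
  obtain ⟨hl⟩ := hS.isKernel _ h.2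
  exact ⟨_, (KernelFork.IsLimit.lift' hl x hx).2⟩

lemma exists_desc (hS : IsExactCategory S) (h : IsConf S i p) {W : C} (x : Y ⟶ W)
    (hx : i ≫ x = 0) : ∃ l : Z ⟶ W, p ≫ l = x := by
  obtain ⟨hl⟩ := hS.isCokernel _ h.2
  exact ⟨_, (CokernelCofork.IsColimit.desc' hl x hx).2⟩

lemma mono (hS : IsExactCategory S) (h : IsConf S i p) : Mono i := by
  obtain ⟨hl⟩ := hS.isKernel _ h.2
  exact mono_of_isLimit_fork hl

lemma epi (hS : IsExactCategory S) (h : IsConf S i p) : Epi p := by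
  obtain ⟨hl⟩ := hS.isCokernel _ h.2
  exact epi_of_isColimit_cofork hl

lemma of_iso (hS : IsExactCategory S) (h : IsConf S i p) {X' Y' Z' : C} {i' : X' ⟶ Y'}
    {p' : Y' ⟶ Z'} (a : X ≅ X') (b : Y ≅ Y') (c : Z ≅ Z') (hi : a.hom ≫ i' = i ≫ b.hom)
    (hp : b.hom ≫ p' = p ≫ c.hom) : IsConf S i' p' := by
  have h0 : i' ≫ p' = 0 := by
    rw [← cancel_epi a.hom, ← Category.assoc, hi, Category.assoc, hp, ← Category.assoc, h.zero]
    simp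
  have := hS.iso_closed
  exact ⟨h0, S.prop_of_iso (ShortComplex.isoMk a b c hi hp) h.2⟩

/-- Any two kernels of a deflation are isomorphic, and conflations are closed under isomorphism. -/
lemma of_kernel (hS : IsExactCategory S) {X Y Z : C} {i : X ⟶ Y} {p : Y ⟶ Z}
    (hp : IsDeflation S p) (h0 : i ≫ p = 0) [Mono i]
    (hl : ∀ {W : C} (x : W ⟶ Y), x ≫ p = 0 → ∃ l : W ⟶ X, l ≫ i = x) : IsConf S i p := by
  obtain ⟨X', i', h⟩ := hp
  have h : IsConf S i' p := h
  have := h.mono hS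
  obtain ⟨a, ha⟩ := hl i' h.zero
  obtain ⟨b, hb⟩ := h.exists_lift hS i h0
  refine h.of_iso hS ⟨a, b, ?_, ?_⟩ (Iso.refl _) (Iso.refl _) (by simp [ha]) (by simp)
  · rw [← cancel_mono i']; simp [ha, hb]
  · rw [← cancel_mono i]; simp [ha, hb]

lemma of_cokernel (hS : IsExactCategory S) {X Y Z : C} {i : X ⟶ Y} {p : Y ⟶ Z}
    (hi : IsInflation S i) (h0 : i ≫ p = 0) [Epi p]
    (hl : ∀ {W : C} (x : Y ⟶ W), i ≫ x = 0 → ∃ l : Z ⟶ W, p ≫ l = x) : IsConf S i p := by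
  obtain ⟨Z', p', h⟩ := hi
  have h : IsConf S i p' := h
  have := h.epi hS
  obtain ⟨a, ha⟩ := hl p' h.zero
  obtain ⟨b, hb⟩ := h.exists_desc hS p h0
  refine h.of_iso hS (Iso.refl _) (Iso.refl _) ⟨b, a, ?_, ?_⟩ (by simp) (by simp [hb])
  · rw [← cancel_epi p']; simp [reassoc_of% hb, ha]
  · rw [← cancel_epi p]; simp [reassoc_of% ha, hb]

/-- Pushout of a conflation along a morphism. -/
lemma exists_pushout (hS : IsExactCategory S) (h : IsConf S i p) {X' : C} (f : X ⟶ X') :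
    ∃ (Y' : C) (f' : Y ⟶ Y') (i' : X' ⟶ Y') (p' : Y' ⟶ Z),
      IsPushout i f f' i' ∧ IsConf S i' p' ∧ f' ≫ p' = p := by
  obtain ⟨Y', f', i', hp, hi⟩ := hS.pushout_inflation i f h.isInflation
  have hw : i ≫ p = f ≫ (0 : X' ⟶ Z) := by simp [h.zero]
  have e1 : f' ≫ hp.desc p 0 hw = p := hp.inl_desc _ _ _
  have e2 : i' ≫ hp.desc p 0 hw = 0 := hp.inr_desc _ _ _
  have := h.epi hS
  have : Epi (hp.desc p 0 hw) := epi_of_epi_fac e1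
  refine ⟨Y', f', i', hp.desc p 0 hw, hp, of_cokernel hS hi e2 fun {W} x hx => ?_, e1⟩
  obtain ⟨l, hl⟩ := h.exists_desc hS (f' ≫ x) (by rw [hp.w_assoc, hx, comp_zero])
  refine ⟨l, hp.hom_ext ?_ ?_⟩
  · rw [reassoc_of% e1, hl]
  · rw [reassoc_of% e2, hx, zero_comp]

/-- Pullback of a conflation along a morphism. -/
lemma exists_pullback (hS : IsExactCategory S) (h : IsConf S i p) {Z' : C} (f : Z' ⟶ Z) :
    ∃ (Y' : C) (f' : Y' ⟶ Y) (i' : X ⟶ Y') (p' : Y' ⟶ Z'),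
      IsPullback f' p' p f ∧ IsConf S i' p' ∧ i' ≫ f' = i := by
  obtain ⟨Y', f', p', hp, hi⟩ := hS.pullback_deflation p f h.isDeflation
  have hw : i ≫ p = (0 : X ⟶ Z') ≫ f := by simp [h.zero]
  have e1 : hp.lift i 0 hw ≫ f' = i := hp.lift_fst _ _ _
  have e2 : hp.lift i 0 hw ≫ p' = 0 := hp.lift_snd _ _ _
  have := h.mono hS
  have : Mono (hp.lift i 0 hw) := mono_of_mono_fac e1
  refine ⟨Y', f', hp.lift i 0 hw, p', hp, of_kernel hS hi e2 fun {W} x hx => ?_, e1⟩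
  obtain ⟨l, hl⟩ := h.exists_lift hS (x ≫ f') (by rw [Category.assoc, hp.w, reassoc_of% hx, zero_comp])
  refine ⟨l, hp.hom_ext ?_ ?_⟩
  · rw [Category.assoc, e1, hl]
  · rw [Category.assoc, e2, hx, comp_zero]

/-- The splitting maps of a conflation with a retraction. -/
lemma exists_section (hS : IsExactCategory S) (h : IsConf S i p) (r : Y ⟶ X) (hr : i ≫ r = 𝟙 X) :
    ∃ s : Z ⟶ Y, s ≫ p = 𝟙 Z ∧ s ≫ r = 0 ∧ r ≫ i + p ≫ s = 𝟙 Y := by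
  obtain ⟨s, hs⟩ := h.exists_desc hS (𝟙 Y - r ≫ i) (by simp [reassoc_of% hr])
  have := h.epi hS
  refine ⟨s, ?_, ?_, by simp [hs]⟩
  · rw [← cancel_epi p, reassoc_of% hs]; simp [h.zero]
  · rw [← cancel_epi p, reassoc_of% hs]; simp [hr]

lemma exists_retraction (hS : IsExactCategory S) (h : IsConf S i p) (s : Z ⟶ Y)
    (hs : s ≫ p = 𝟙 Z) : ∃ r : Y ⟶ X, i ≫ r = 𝟙 X := by
  obtain ⟨r, hr⟩ := h.exists_lift hS (𝟙 Y - p ≫ s) (by simp [hs])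
  have := h.mono hS
  refine ⟨r, ?_⟩
  rw [← cancel_mono i, Category.assoc, hr]; simp [reassoc_of% h.zero]

/-- Pushout of a conflation along a deflation. -/
lemma exists_pushout_deflation (hS : IsExactCategory S) (h : IsConf S i p) {L X' : C}
    {k : L ⟶ X} {f : X ⟶ X'} (hf : IsConf S k f) :
    ∃ (Y' : C) (f' : Y ⟶ Y') (i' : X' ⟶ Y') (p' : Y' ⟶ Z),
      IsConf S i' p' ∧ IsConf S (k ≫ i) f' ∧ i ≫ f' = f ≫ i' ∧ f' ≫ p' = p := by
  obtain ⟨Y', f', i', p', hp, hc, e⟩ := h.exists_pushout hS f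
  refine ⟨Y', f', i', p', hc, ?_, hp.w, e⟩
  have := hf.epi hS
  -- A pushout of the epimorphism `f` is epi. It remains to see `f'` as a cokernel of the composite
  -- inflation `k ≫ i`.
  have hepi : ∀ {W : C} (a b : Y' ⟶ W), f' ≫ a = f' ≫ b → a = b := fun a b hab =>
    hp.hom_ext hab (by rw [← cancel_epi f, ← hp.w_assoc, hab, hp.w_assoc])
  have : Epi f' := ⟨fun a b => hepi a b⟩
  refine of_cokernel hS (hS.comp_inflation _ _ hf.isInflation h.isInflation)
    (by rw [Category.assoc, hp.w, reassoc_of% hf.zero, zero_comp]) fun {W} x hx => ?_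
  obtain ⟨l, hl⟩ := hf.exists_desc hS (i ≫ x) (by rw [← Category.assoc, hx])
  exact ⟨hp.desc x l hl.symm, hp.inl_desc _ _ _⟩

end IsConf

namespace IsExactCategory

lemma isConf_id_zero (hS : IsExactCategory S) (X : C) {Z : C} (hZ : IsZero Z) :
    IsConf S (𝟙 X) (0 : X ⟶ Z) := by
  have : Epi (0 : X ⟶ Z) := ⟨fun a b _ => hZ.eq_of_src a b⟩
  exact IsConf.of_cokernel hS (hS.id_inflation X) (by simp) fun x hx => ⟨0, by simpa using hx.symm⟩

lemma isConf_zero_id (hS : IsExactCategory S) (X : C) {Z : C} (hZ : IsZero Z) :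
    IsConf S (0 : Z ⟶ X) (𝟙 X) := by
  have : Mono (0 : Z ⟶ X) := ⟨fun a b _ => hZ.eq_of_tgt a b⟩
  exact IsConf.of_kernel hS (hS.id_deflation X) (by simp) fun x hx => ⟨0, by simpa using hx.symm⟩

lemma exists_isZero (hS : IsExactCategory S) : ∃ Z : C, IsZero Z := by
  have := hS.additive
  have := hasZeroObject_of_hasFiniteBiproducts C
  exact ⟨_, isZero_zero C⟩

/-- Pushing `0 ↣ Y ↠ Y` out along `0 ⟶ X` gives a conflation whose middle term is a coproduct of `X`
and `Y`, hence isomorphic to `Z`. -/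
lemma isConf_of_split (hS : IsExactCategory S) {X Y Z : C} {i : X ⟶ Z} {s : Y ⟶ Z} {r : Z ⟶ X}
    {p : Z ⟶ Y} (hr : i ≫ r = 𝟙 X) (hs : s ≫ p = 𝟙 Y) (h0 : i ≫ p = 0) (h0' : s ≫ r = 0)
    (h1 : r ≫ i + p ≫ s = 𝟙 Z) : IsConf S i p := by
  obtain ⟨O, hO⟩ := hS.exists_isZero
  obtain ⟨Y', f', i', p', hp, hc, e⟩ :=
    (hS.isConf_zero_id Y hO).exists_pushout hS (0 : O ⟶ X)
  obtain ⟨r', hr'⟩ := hc.exists_retraction hS f' e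
  have hw : (0 : O ⟶ Y) ≫ s = (0 : O ⟶ X) ≫ i := by simp
  have e1 : f' ≫ hp.desc s i hw = s := hp.inl_desc _ _ _
  have e2 : i' ≫ hp.desc s i hw = i := hp.inr_desc _ _ _
  refine hc.of_iso hS (Iso.refl _) ⟨hp.desc s i hw, r ≫ i' + p ≫ f', ?_, ?_⟩ (Iso.refl _)
    (by simp [e2]) ?_
  · refine hp.hom_ext ?_ ?_
    · simp [reassoc_of% e1, reassoc_of% hs, reassoc_of% h0']
    · simp [reassoc_of% e2, reassoc_of% hr, reassoc_of% h0]
  · simp [e1, e2, h1]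
  · refine hp.hom_ext ?_ ?_
    · simp [reassoc_of% e1, hs, e]
    · simp [reassoc_of% e2, h0, hc.zero]

lemma isConf_biprod (hS : IsExactCategory S) (X Y : C) [HasBinaryBiproduct X Y] :
    IsConf S (biprod.inl : X ⟶ X ⊞ Y) biprod.snd :=
  hS.isConf_of_split (s := biprod.inr) (r := biprod.fst) (by simp) (by simp) (by simp) (by simp)
    (by simp)

end IsExactCategory

/-- If `f ≫ g` is a deflation, then so is `g`, provided that `f` is a deflation and `g` has a
kernel. -/
lemma isDeflation_of_comp_of_kernel (hS : IsExactCategory S) {A B D K : C} {f : A ⟶ B} {g : B ⟶ D}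
    {k : K ⟶ B} (hf : IsDeflation S f) (hfg : IsDeflation S (f ≫ g)) [Mono k] (hk : k ≫ g = 0)
    (hl : ∀ {W : C} (x : W ⟶ B), x ≫ g = 0 → ∃ l : W ⟶ K, l ≫ k = x) : IsDeflation S g := by
  obtain ⟨M, m, hf⟩ := hf
  have hf : IsConf S m f := hf
  -- The preimage `N` of `K` in `A` is the kernel of `f ≫ g`. Pushing `N ↣ A ↠ D` out along `N ↠ K`
  -- gives `K ↣ B' ↠ D`; both `A ↠ B'` and `f` are cokernels of `m`, so `B' ≅ B`.
  obtain ⟨N, f', m', n, hp, hc, e⟩ := hf.exists_pullback hS k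
  have hn : IsConf S f' (f ≫ g) := by
    have : Mono f' := ⟨fun a b hab => hp.hom_ext hab (by
      rw [← cancel_mono k, Category.assoc, Category.assoc, ← hp.w, reassoc_of% hab])⟩
    refine .of_kernel hS hfg (by rw [hp.w_assoc, hk, comp_zero]) fun {W} x hx => ?_
    obtain ⟨l, hl⟩ := hl (x ≫ f) (by simpa using hx)
    exact ⟨hp.lift x l hl.symm, hp.lift_fst _ _ _⟩
  obtain ⟨B', φ, k', g', hc', hφ, e1, e2⟩ := hn.exists_pushout_deflation hS hc
  rw [e] at hφ
  have := hf.epi hS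
  have := hφ.epi hS
  obtain ⟨a, ha⟩ := hφ.exists_desc hS f hf.zero
  obtain ⟨b, hb⟩ := hf.exists_desc hS φ hφ.zero
  have hab : a ≫ b = 𝟙 B' := by rw [← cancel_epi φ, reassoc_of% ha, hb, Category.comp_id]
  have hba : b ≫ a = 𝟙 B := by rw [← cancel_epi f, reassoc_of% hb, ha, Category.comp_id]
  exact (hc'.of_iso hS (i' := k' ≫ a) (p' := g) (Iso.refl _) ⟨a, b, hab, hba⟩ (Iso.refl _)
    (by simp) (by rw [← cancel_epi φ]; simp [reassoc_of% ha, e2])).isDeflation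

/-- In a weakly idempotent complete category, every retraction has a kernel. -/
lemma WeaklyIdempotentComplete.exists_kernel (hC : WeaklyIdempotentComplete C) {X Y : C}
    (s : X ⟶ Y) (r : Y ⟶ X) (h : s ≫ r = 𝟙 X) :
    ∃ (K : C) (i : K ⟶ Y) (q : Y ⟶ K), i ≫ q = 𝟙 K ∧ i ≫ r = 0 ∧ s ≫ q = 0 ∧
      q ≫ i + r ≫ s = 𝟙 Y := by
  have := hC s r h
  have e : cokernel.π s ≫ cokernel.desc s (𝟙 Y - r ≫ s) (by simp [reassoc_of% h]) = 𝟙 Y - r ≫ s :=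
    cokernel.π_desc _ _ _
  refine ⟨cokernel s, cokernel.desc s (𝟙 Y - r ≫ s) (by simp [reassoc_of% h]), cokernel.π s,
    ?_, ?_, by simp, by rw [e]; simp⟩
  · rw [← cancel_epi (cokernel.π s), reassoc_of% e]; simp
  · rw [← cancel_epi (cokernel.π s), reassoc_of% e]; simp [h]

/-- In a weakly idempotent complete exact category, if `f ≫ g` is a deflation, then so is `g`. -/
lemma isDeflation_of_comp (hS : IsExactCategory S) (hC : WeaklyIdempotentComplete C) {A B D : C}
    {f : A ⟶ B} {g : B ⟶ D} (hfg : IsDeflation S (f ≫ g)) : IsDeflation S g := by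
  -- The pair `(𝟙, f)` splits `eA`, so `eA` has a kernel `κ`, and `κ ≫ eB` is then a kernel of `g`.
  -- Since `eB ≫ g = eA ≫ f ≫ g` is a deflation, the previous lemma applies to `eB` and `g`.
  obtain ⟨E, eA, eB, hp, heB⟩ := hS.pullback_deflation (f ≫ g) g hfg
  have hw : 𝟙 A ≫ f ≫ g = f ≫ g := by simp
  obtain ⟨K, κ, ρ, h1, h2, h3, h4⟩ :=
    hC.exists_kernel (hp.lift (𝟙 A) f hw) eA (hp.lift_fst _ _ _)
  have heA : IsDeflation S eA :=
    (hS.isConf_of_split h1 (hp.lift_fst _ _ _) h2 h3 h4).isDeflation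
  have hmono : Mono (κ ≫ eB) := ⟨fun a b hab => by
    have : a ≫ κ = b ≫ κ := hp.hom_ext (by simp [h2]) (by simpa using hab)
    simpa [h1] using congrArg (· ≫ ρ) this⟩
  refine isDeflation_of_comp_of_kernel hS (k := κ ≫ eB) heB ?_ ?_ fun {W} x hx => ?_
  · rw [← hp.w]
    exact hS.comp_deflation _ _ heA hfg
  · rw [Category.assoc, ← hp.w, reassoc_of% h2, zero_comp]
  · have hw : (0 : W ⟶ A) ≫ f ≫ g = x ≫ g := by rw [hx, zero_comp]
    refine ⟨hp.lift 0 x hw ≫ ρ, ?_⟩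
    have := congrArg (hp.lift 0 x hw ≫ ·) h4
    simp only [Preadditive.comp_add, hp.lift_fst_assoc, zero_comp, add_zero,
      Category.comp_id] at this
    rw [Category.assoc, ← Category.assoc ρ, ← Category.assoc, this]
    exact hp.lift_snd _ _ _

end Toolbox

end QuillenExact

namespace QuillenExact

/-! ### Yoneda extensions and their vanishing. -/

section Extensions

variable {C : Type u} [Category.{v} C] [Preadditive C] {S : ObjectProperty (ShortComplex C)}

lemma Conflation.isConf {X Y : C} (E : Conflation S X Y) : IsConf S E.i E.p := ⟨E.zero, E.mem⟩

/-- The conflation given by a pair of morphisms. -/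
def IsConf.toConflation {X Y Z : C} {i : X ⟶ Y} {p : Y ⟶ Z} (h : IsConf S i p) :
    Conflation S X Z := ⟨Y, i, p, h.1, h.2⟩

/-- `Ext^1(X, Y) = 0` if and only if every conflation `Y ↣ M ↠ X` splits. -/
lemma extVanishes_one_iff (hS : IsExactCategory S) {X Y : C} :
    ExtVanishes S 1 X Y ↔
      ∀ {M : C} (i : Y ⟶ M) (p : M ⟶ X), IsConf S i p → ∃ r : M ⟶ Y, i ≫ r = 𝟙 Y := by
  constructor
  · intro h M i p hc
    -- Being split is invariant under morphisms of extensions, so it descends to the quotient, where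
    -- every class equals that of the biproduct.
    let splits : Ext S 1 X Y → Prop :=
      Quot.lift (fun E : Conflation S Y X => ∃ r : E.mid ⟶ Y, E.i ≫ r = 𝟙 Y) (by
        rintro (E : Conflation S Y X) (E' : Conflation S Y X) ⟨z, h1, h2⟩
        refine propext ⟨fun ⟨r, hr⟩ => ?_, fun ⟨r, hr⟩ => ⟨z ≫ r, ?_⟩⟩
        · obtain ⟨s, hs, -⟩ := E.isConf.exists_section hS r hr
          refine E'.isConf.exists_retraction hS (s ≫ z) ?_
          rw [Category.assoc, ← h2, Category.comp_id, hs]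
        · rw [reassoc_of% h1, hr])
    have := hS.additive
    have := hasBinaryBiproducts_of_finite_biproducts C
    have e := h.elim (Quot.mk _ (hS.isConf_biprod Y X).toConflation) (Quot.mk _ hc.toConflation)
    have h1 : splits (Quot.mk _ (hS.isConf_biprod Y X).toConflation) :=
      ⟨biprod.fst, biprod.inl_fst⟩
    rw [e] at h1
    exact h1
  · intro h
    refine ⟨fun a b => ?_⟩
    induction a using Quot.ind with | _ E
    induction b using Quot.ind with | _ E'
    obtain ⟨r, hr⟩ := h _ _ (Conflation.isConf (S := S) E)
    obtain ⟨r', hr'⟩ := h _ _ (Conflation.isConf (S := S) E')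
    obtain ⟨s', hs', -⟩ := (Conflation.isConf (S := S) E').exists_section hS r' hr'
    refine Quot.sound ⟨r ≫ Conflation.i E' + Conflation.p E ≫ s', ?_, ?_⟩
    · simp [reassoc_of% hr, reassoc_of% (Conflation.isConf (S := S) E).zero]
    · simp [hs', (Conflation.isConf (S := S) E').zero]

lemma ExtensionMap.refl (n : ℕ) {X Y : C} (E : Extension S n X Y) :
    ExtensionMap S n E E (𝟙 X) (𝟙 Y) := by
  induction n generalizing X with
  | zero => exact ⟨𝟙 _, by simp, by simp⟩
  | succ n ih =>
    obtain ⟨W, E, F⟩ := E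
    exact ⟨𝟙 _, 𝟙 _, by simp, by simp, ih F⟩

/-- The extension `Y = Y → 0 → ⋯ → 0` of a zero object. -/
def zeroExtension (hS : IsExactCategory S) {O : C} (hO : IsZero O) (Y : C) :
    ∀ n : ℕ, Extension S n O Y
  | 0 => (hS.isConf_id_zero Y hO).toConflation
  | n + 1 => ⟨O, (hS.isConf_zero_id O hO).toConflation, zeroExtension hS hO Y n⟩

lemma extensionMap_zeroExtension (hS : IsExactCategory S) {O : C} (hO : IsZero O) {Y : C} (n : ℕ)
    {W : C} (F : Extension S n W Y) :
    ExtensionMap S n (zeroExtension hS hO Y n) F 0 (𝟙 Y) := by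
  induction n generalizing W with
  | zero =>
    exact ⟨Conflation.i F, rfl,
      (hO.eq_of_src _ _ : (0 : O ⟶ W) = 0) ▸ (by
        rw [comp_zero]; exact (Conflation.zero F).symm)⟩
  | succ n ih =>
    obtain ⟨V, E, F⟩ := F
    exact ⟨0, 0, hO.eq_of_src _ _, hO.eq_of_src _ _, ih F⟩

/-- Conflations ending in `X` lift along deflations between their kernels; that is,
`Ext^1(X, -)` is right exact. -/
def LiftsConflations (S : ObjectProperty (ShortComplex C)) (X : C) : Prop :=
  ∀ {U Y Z E : C} (i : U ⟶ Y) (p : Y ⟶ Z) (j : Z ⟶ E) (q : E ⟶ X), IsConf S i p → IsConf S j q →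
    ∃ (E' : C) (j' : Y ⟶ E') (e : E' ⟶ E), IsConf S j' (e ≫ q) ∧ j' ≫ e = p ≫ j

/-- If `Ext^1(X, -)` is right exact, then the higher extension groups of `X` vanish. -/
lemma LiftsConflations.extVanishes (hS : IsExactCategory S) {X : C} (hX : LiftsConflations S X)
    (n : ℕ) (Y : C) : ExtVanishes S (n + 2) X Y := by
  have := hS.additive
  have := hasBinaryBiproducts_of_finite_biproducts C
  obtain ⟨O, hO⟩ := hS.exists_isZero
  let triv : Extension S (n + 1) X Y :=
    ⟨O, (hS.isConf_zero_id X hO).toConflation, zeroExtension hS hO Y n⟩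
  suffices key : ∀ E : Extension S (n + 1) X Y,
      (Quot.mk _ E : Ext S (n + 2) X Y) = Quot.mk _ triv by
    refine ⟨fun a b => ?_⟩
    induction a using Quot.ind with | _ a
    induction b using Quot.ind with | _ b
    exact (key a).trans (key b).symm
  rintro ⟨W, c, F⟩
  cases n with
  | zero =>
    obtain ⟨E', j', e, hc, he⟩ := hX _ _ _ _ (Conflation.isConf (S := S) F) c.isConf
    -- The lifted conflation, spliced with a split one, maps both to the given extension and to the
    -- trivial one: a two-step zigzag.
    let roof : Extension S 1 X Y :=
      ⟨Conflation.mid F, hc.toConflation, (hS.isConf_biprod Y (Conflation.mid F)).toConflation⟩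
    have h1 : (Quot.mk _ roof : Ext S 2 X Y) = Quot.mk _ ⟨W, c, F⟩ := by
      refine Quot.sound ⟨Conflation.p F, e, he, by simp [IsConf.toConflation],
        biprod.desc (Conflation.i F) (𝟙 _), ?_, ?_⟩
      · simp [IsConf.toConflation]
      · apply biprod.hom_ext' <;> simp [IsConf.toConflation, (Conflation.isConf (S := S) F).zero]
    have h2 : (Quot.mk _ roof : Ext S 2 X Y) = Quot.mk _ triv := by
      refine Quot.sound ⟨0, e ≫ c.p, ?_, ?_, biprod.fst, ?_, ?_⟩
      · simpa [IsConf.toConflation] using hc.zero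
      · simp [IsConf.toConflation]
      · simp [IsConf.toConflation, zeroExtension]
      · simp [IsConf.toConflation, zeroExtension]
    exact h1.symm.trans h2
  | succ n =>
    obtain ⟨V, d, G⟩ := F
    obtain ⟨E', j', e, hc, he⟩ := hX _ _ _ _ d.isConf c.isConf
    let roof : Extension S (n + 2) X Y :=
      ⟨d.mid, hc.toConflation, V, (hS.isConf_biprod V d.mid).toConflation, G⟩
    let mid : Extension S (n + 2) X Y :=
      ⟨O, (hS.isConf_zero_id X hO).toConflation, V, (hS.isConf_id_zero V hO).toConflation, G⟩
    have h1 : (Quot.mk _ roof : Ext S (n + 3) X Y) = Quot.mk _ ⟨W, c, V, d, G⟩ := by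
      refine Quot.sound ⟨d.p, e, he, by simp [IsConf.toConflation], 𝟙 V,
        biprod.desc d.i (𝟙 _), ?_, ?_, ExtensionMap.refl _ _⟩
      · simp [IsConf.toConflation]
      · apply biprod.hom_ext' <;> simp [IsConf.toConflation, d.zero]
    have h2 : (Quot.mk _ roof : Ext S (n + 3) X Y) = Quot.mk _ mid := by
      refine Quot.sound ⟨0, e ≫ c.p, ?_, ?_, 𝟙 V, biprod.fst, ?_, ?_, ExtensionMap.refl _ _⟩
      · simpa [IsConf.toConflation] using hc.zero
      · simp [IsConf.toConflation]
      · simp [IsConf.toConflation]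
      · simp [IsConf.toConflation]
    -- The second leg of the roof keeps the tail `G`; the extension of the zero object maps into any
    -- tail and removes it.
    have h3 : (Quot.mk _ triv : Ext S (n + 3) X Y) = Quot.mk _ mid := by
      refine Quot.sound ⟨0, 𝟙 X, ?_, ?_, extensionMap_zeroExtension hS hO _ _⟩
      · simp [IsConf.toConflation]
      · simp [IsConf.toConflation]
    exact h1.symm.trans (h2.trans h3.symm)

end Extensions

/-! ### Conflations in full subcategories. -/

section Restriction

variable {C : Type u} [Category.{v} C] [Preadditive C] {S : ObjectProperty (ShortComplex C)}
  {A : ObjectProperty C}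

lemma isConf_restrict_iff {X Y Z : A.FullSubcategory} {i : X ⟶ Y} {p : Y ⟶ Z} :
    IsConf (restrict S A) i p ↔ IsConf S i.hom p.hom :=
  ⟨fun h => ⟨congrArg (·.hom) h.1, h.2⟩, fun h => ⟨A.hom_ext h.1, h.2⟩⟩

lemma IsDirectSum.obj {X Y Z : A.FullSubcategory} (h : IsDirectSum X Y Z) :
    IsDirectSum X.obj Y.obj Z.obj := by
  obtain ⟨i, j, p, q, h1, h2, h3, h4, h5⟩ := h
  exact ⟨i.hom, j.hom, p.hom, q.hom, congrArg (·.hom) h1, congrArg (·.hom) h2,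
    congrArg (·.hom) h3, congrArg (·.hom) h4, congrArg (·.hom) h5⟩

lemma IsAdditivelyClosed.inverseImage_ι {T : ObjectProperty C} (hT : IsAdditivelyClosed T)
    (A : ObjectProperty C) : IsAdditivelyClosed (T.inverseImage A.ι) where
  zero _ hZ := hT.zero _ ((IsZero.iff_id_eq_zero _).2
    (congrArg (·.hom) ((IsZero.iff_id_eq_zero _).1 hZ)))
  sum _ _ _ h := hT.sum _ _ _ h.obj
  summand _ _ _ h := hT.summand _ _ _ h.obj

end Restriction

/-! ### Tilting from embeddings into `Fac T`. -/

section Tilting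

variable {C : Type u} [Category.{v} C] [Preadditive C] {S : ObjectProperty (ShortComplex C)}
  {T : ObjectProperty C}

lemma le_fac (hS : IsExactCategory S) (T : ObjectProperty C) : T ≤ Fac S T :=
  fun X hX => ⟨X, 𝟙 X, hX, hS.id_deflation X⟩

lemma Fac.of_deflation (hS : IsExactCategory S) {X Y : C} (hX : Fac S T X) {p : X ⟶ Y}
    (hp : IsDeflation S p) : Fac S T Y := by
  obtain ⟨A, q, hA, hq⟩ := hX
  exact ⟨A, q ≫ p, hA, hS.comp_deflation _ _ hq hp⟩

/-- Every object is an admissible subobject of an object of `Fac T`, with cokernel in `Q`. -/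
def EmbedsInFac (S : ObjectProperty (ShortComplex C)) (T Q : ObjectProperty C) : Prop :=
  ∀ X : C, ∃ (F G : C) (i : X ⟶ F) (p : F ⟶ G), IsConf S i p ∧ Fac S T F ∧ Q G

lemma IsTauRigid.exists_retraction (hS : IsExactCategory S) (hT : IsTauRigid S T) {X Y M : C}
    (hX : T X) (hY : Fac S T Y) {i : Y ⟶ M} {p : M ⟶ X} (h : IsConf S i p) :
    ∃ r : M ⟶ Y, i ≫ r = 𝟙 Y :=
  (extVanishes_one_iff hS).1 (hT.ext_fac X Y hX hY) i p h

/-- Embed `Y` in `F` in `Fac T` and push out along `Y ↠ Z`: this embeds `Z` in a quotient `F'` of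
`F`, again in `Fac T`. Rigidity extends `Z ⟶ F'` to `E ⟶ F'`, and `E'` is the pullback of `F ↠ F'`
along this extension. -/
lemma IsTauRigid.liftsConflations (hS : IsExactCategory S) (hT : IsTauRigid S T)
    {Q : ObjectProperty C} (hF : EmbedsInFac S T Q) {X : C} (hX : T X) :
    LiftsConflations S X := by
  intro U Y Z E i p j q hip hjq
  obtain ⟨F, G, a, g, hag, hFac, -⟩ := hF Y
  obtain ⟨F', φ, a', g', hag', hφ, e1, e2⟩ := hag.exists_pushout_deflation hS hip
  obtain ⟨M, b, a'', p'', hpo, hM, e3⟩ := hjq.exists_pushout hS a'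
  obtain ⟨r, hr⟩ := hT.exists_retraction hS hX (hFac.of_deflation hS hφ.isDeflation) hM
  have hbr : j ≫ b ≫ r = a' := by rw [hpo.w_assoc, hr, Category.comp_id]
  obtain ⟨E', u, e, hpb, he⟩ := hS.pullback_deflation φ (b ≫ r) hφ.isDeflation
  have hw : a ≫ φ = (p ≫ j) ≫ b ≫ r := by rw [Category.assoc, hbr, e1]
  have := hag.mono hS
  have := hag'.mono hS
  have hu : hpb.lift a (p ≫ j) hw ≫ u = a := hpb.lift_fst _ _ _
  have hv : hpb.lift a (p ≫ j) hw ≫ e = p ≫ j := hpb.lift_snd _ _ _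
  have : Mono (hpb.lift a (p ≫ j) hw) := mono_of_mono_fac hu
  refine ⟨E', hpb.lift a (p ≫ j) hw, e, .of_kernel hS
    (hS.comp_deflation _ _ he hjq.isDeflation) ?_ fun {W} x hx => ?_, hv⟩
  · rw [reassoc_of% hv, hjq.zero, comp_zero]
  · obtain ⟨l, hl⟩ := hjq.exists_lift hS (x ≫ e) (by simpa using hx)
    have hxu : x ≫ u ≫ φ = l ≫ a' := by rw [hpb.w, ← reassoc_of% hl, hbr]
    -- `F` and `F'` have the same quotient `G` by `Y` and `Z`; a map to `F` landing in `Z` inside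
    -- `F'` therefore lands in `Y`.
    obtain ⟨m, hm⟩ := hag.exists_lift hS (x ≫ u) (by
      rw [← e2, Category.assoc, reassoc_of% hxu, hag'.zero, comp_zero])
    have hml : m ≫ p = l := by
      rw [← cancel_mono a', Category.assoc, ← e1, reassoc_of% hm, hxu]
    refine ⟨m, hpb.hom_ext ?_ ?_⟩
    · rw [Category.assoc, hu, hm]
    · rw [Category.assoc, hv, reassoc_of% hml, hl]

lemma IsTauRigid.fac_le_rightPerp (hS : IsExactCategory S) (hT : IsTauRigid S T)
    {Q : ObjectProperty C} (hF : EmbedsInFac S T Q) : Fac S T ≤ rightPerp S T := by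
  rintro Y hY (_ | _ | n) hn X hX
  · omega
  · exact hT.ext_fac X Y hX hY
  · exact LiftsConflations.extVanishes hS (hT.liftsConflations hS hF hX) n Y

lemma IsTauRigid.isPartialTilting (hS : IsExactCategory S) (hT : IsTauRigid S T)
    {Q : ObjectProperty C} (hF : EmbedsInFac S T Q) : IsPartialTilting S T where
  additivelyClosed := hT.additivelyClosed
  selfOrthogonal := (le_fac hS T).trans (hT.fac_le_rightPerp hS hF)
  projDim _ hX Y := LiftsConflations.extVanishes hS (hT.liftsConflations hS hF hX) 0 Y

lemma exists_retraction_of_rightPerp (hS : IsExactCategory S) {X Y M : C}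
    (hX : T X) (hY : rightPerp S T Y) {i : Y ⟶ M} {p : M ⟶ X} (h : IsConf S i p) :
    ∃ r : M ⟶ Y, i ≫ r = 𝟙 Y :=
  (extVanishes_one_iff hS).1 (hY 1 le_rfl X hX) i p h

/-- The embedding `Y ↣ F ↠ G` splits because `G` is in `T`, so `Y` is a quotient of `F`. -/
lemma rightPerp_le_fac (hS : IsExactCategory S) (hF : EmbedsInFac S T T) :
    rightPerp S T ≤ Fac S T := by
  intro Y hY
  obtain ⟨F, G, i, p, h, hFac, hG⟩ := hF Y
  obtain ⟨r, hr⟩ := exists_retraction_of_rightPerp hS hG hY h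
  obtain ⟨s, h1, h2, h3⟩ := h.exists_section hS r hr
  exact hFac.of_deflation hS
    (hS.isConf_of_split h1 hr h2 h.zero (by rw [add_comm, h3])).isDeflation

/-- Every object of `Fac T` is the end term of a conflation with middle term in `T` and first
term in `Fac T`. -/
lemma IsTauRigid.exists_conf_of_fac (hS : IsExactCategory S) (hT : IsTauRigid S T)
    (hF : EmbedsInFac S T T) {Y : C} (hY : Fac S T Y) :
    ∃ (F E : C) (i : F ⟶ E) (p : E ⟶ Y), IsConf S i p ∧ Fac S T F ∧ T E := by
  obtain ⟨A, q, hA, M, m, hm⟩ := hY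
  have hm : IsConf S m q := hm
  obtain ⟨F, G, a, g, hag, hFac, hG⟩ := hF M
  obtain ⟨E, f, a', q', hpo, hc, e⟩ := hm.exists_pushout hS a
  have hw : m ≫ (0 : A ⟶ G) = a ≫ g := by rw [comp_zero, hag.zero]
  have e1 : f ≫ hpo.desc 0 g hw = 0 := hpo.inl_desc _ _ _
  have e2 : a' ≫ hpo.desc 0 g hw = g := hpo.inr_desc _ _ _
  -- Read in the other direction, the same pushout square gives `A ↣ E ↠ G`. It splits by rigidity,
  -- so `E` is a direct sum of `A` and `G`.
  obtain ⟨E₂, m₂, f₂, g₂, hpo₂, hc₂, e₂⟩ := hag.exists_pushout hS m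
  have hcE : IsConf S f (hpo.desc 0 g hw) := by
    refine hc₂.of_iso hS (Iso.refl _) (hpo₂.flip.isoIsPushout _ _ hpo) (Iso.refl _) ?_ ?_
    · simp
    · refine hpo₂.hom_ext ?_ ?_ <;> simp [e1, e2, e₂, hc₂.zero]
  obtain ⟨r, hr⟩ := hT.exists_retraction hS hG (le_fac hS T _ hA) hcE
  obtain ⟨s, h1, h2, h3⟩ := hcE.exists_section hS r hr
  exact ⟨F, E, a', q', hc, hFac, hT.additivelyClosed.sum A G E
    ⟨f, s, r, _, hr, h1, e1, h2, h3⟩ hA hG⟩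

/-- Here `T^⊥ = Fac T`. Objects of `T` are projective there because pullbacks of conflations to them
split, and they cover `T^⊥` with kernels in `T^⊥`. -/
lemma IsTauRigid.isTilting (hS : IsExactCategory S) (hT : IsTauRigid S T)
    (hF : EmbedsInFac S T T) : IsTilting S T := by
  have hle := hT.fac_le_rightPerp hS hF
  have hTle := (le_fac hS T).trans hle
  have hproj : ∀ X : (rightPerp S T).FullSubcategory, T X.obj →
      IsProjective (restrict S (rightPerp S T)) X := by
    intro X hX K hK f
    have hc : IsConf S K.f.hom K.g.hom := isConf_restrict_iff.1 ⟨K.zero, hK⟩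
    obtain ⟨E, f', i', p', hpb, hc', e⟩ := hc.exists_pullback hS f.hom
    obtain ⟨r, hr⟩ := exists_retraction_of_rightPerp hS hX K.X₁.property hc'
    obtain ⟨s, hs, -⟩ := hc'.exists_section hS r hr
    refine ⟨ObjectProperty.homMk (s ≫ f'), ObjectProperty.hom_ext _ ?_⟩
    simp [hpb.w, reassoc_of% hs]
  have hcover : ∀ X : (rightPerp S T).FullSubcategory,
      ∃ (F E : (rightPerp S T).FullSubcategory) (i : F ⟶ E) (p : E ⟶ X),
        IsConf (restrict S (rightPerp S T)) i p ∧ T E.obj := by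
    intro X
    obtain ⟨F, E, i, p, hc, hFac, hE⟩ :=
      hT.exists_conf_of_fac hS hF (rightPerp_le_fac hS hF _ X.property)
    exact ⟨⟨F, hle _ hFac⟩, ⟨E, hTle _ hE⟩, ObjectProperty.homMk i, ObjectProperty.homMk p,
      isConf_restrict_iff.2 hc, hE⟩
  refine ⟨hTle, ⟨fun X => ?_, fun X => ⟨fun hX => ?_, hproj X⟩⟩, fun X => ?_⟩
  · obtain ⟨F, E, i, p, hc, hE⟩ := hcover X
    exact ⟨E, p, hproj E hE, hc.isDeflation⟩
  -- A projective object splits its cover by `E` in `T`, hence is a summand of `E`.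
  · obtain ⟨F, E, i, p, hc, hE⟩ := hcover X
    obtain ⟨s, hs⟩ := hX (ShortComplex.mk i p hc.1) hc.2 (𝟙 X)
    have hc' := isConf_restrict_iff.1 hc
    have hs' : s.hom ≫ p.hom = 𝟙 X.obj := congrArg (·.hom) hs
    obtain ⟨r, hr⟩ := hc'.exists_lift hS (𝟙 E.obj - p.hom ≫ s.hom) (by simp [hs'])
    have := hc'.mono hS
    refine hT.additivelyClosed.summand X.obj F.obj E.obj
      ⟨s.hom, i.hom, p.hom, r, hs', ?_, ?_, hc'.zero, by rw [hr]; simp⟩ hE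
    · rw [← cancel_mono i.hom, Category.assoc, hr]; simp [reassoc_of% hc'.zero]
    · rw [← cancel_mono i.hom, Category.assoc, hr]; simp [reassoc_of% hs']
  · obtain ⟨F, G, i, p, hc, hFac, hG⟩ := hF X
    exact ⟨F, G, i, p, hc.1, hc.2, hle _ hFac, ObjectProperty.le_isoClosure _ _ (hTle _ hG)⟩

end Tilting

end QuillenExact

namespace QuillenExact

/-! ### The exact category attached to `T`. -/

section AnnSubcategory

variable {C : Type u} [Category.{v} C] [Preadditive C] {S : ObjectProperty (ShortComplex C)}
  {T : ObjectProperty C}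

lemma le_annSubcategory (S : ObjectProperty (ShortComplex C)) (T : ObjectProperty C) :
    T ≤ annSubcategory S T :=
  fun X hX _ _ _ hf g => hf.2.2 X hX g

lemma annSubcategory_of_mono {X Y : C} (i : X ⟶ Y) [Mono i] (hY : annSubcategory S T Y) :
    annSubcategory S T X := fun Q Q' f hf g => by
  rw [← cancel_mono i, Category.assoc, hY Q Q' f hf, zero_comp]

/-- The target of a morphism in the ideal is projective, so its maps to `Y` lift to `X`. -/
lemma annSubcategory_of_deflation {X Y : C} {p : X ⟶ Y} (hp : IsDeflation S p)
    (hX : annSubcategory S T X) : annSubcategory S T Y := fun Q Q' f hf g => by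
  obtain ⟨K, i, h, hp⟩ := hp
  obtain ⟨g', rfl⟩ := hf.2.1 _ hp g
  rw [← Category.assoc, hX Q Q' f hf, zero_comp]

instance (J : Type*) [Category* J] : (annSubcategory S T).IsClosedUnderLimitsOfShape J where
  limitsOfShape_le := by
    rintro X ⟨h⟩ Q Q' f hf g
    exact h.isLimit.hom_ext fun j => by
      rw [Category.assoc, zero_comp]
      exact h.prop_diag_obj j Q Q' f hf _

lemma isDeflation_ann (hS : IsExactCategory S) {X Y : (annSubcategory S T).FullSubcategory}
    {p : X ⟶ Y} (hp : IsDeflation S p.hom) : IsDeflation (annConflations S T) p := by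
  obtain ⟨K, i, hc⟩ := hp
  have hc : IsConf S i p.hom := hc
  have := hc.mono hS
  exact IsConf.isDeflation (isConf_restrict_iff.2 hc :
    IsConf _ (X := ⟨K, annSubcategory_of_mono i X.property⟩) (ObjectProperty.homMk i) p)

lemma isInflation_ann {X Y : (annSubcategory S T).FullSubcategory}
    {i : X ⟶ Y} (hi : IsInflation S i.hom) : IsInflation (annConflations S T) i := by
  obtain ⟨K, p, hc⟩ := hi
  have hc : IsConf S i.hom p := hc
  exact IsConf.isInflation (isConf_restrict_iff.2 hc :
    IsConf _ (Z := ⟨K, annSubcategory_of_deflation hc.isDeflation Y.property⟩) i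
      (ObjectProperty.homMk p))

lemma IsDeflation.hom {A : ObjectProperty C} {X Y : A.FullSubcategory} {p : X ⟶ Y}
    (hp : IsDeflation (restrict S A) p) : IsDeflation S p.hom := by
  obtain ⟨K, i, hc⟩ := hp
  exact (isConf_restrict_iff.1 hc).isDeflation

lemma IsInflation.hom {A : ObjectProperty C} {X Y : A.FullSubcategory} {i : X ⟶ Y}
    (hi : IsInflation (restrict S A) i) : IsInflation S i.hom := by
  obtain ⟨K, p, hc⟩ := hi
  exact (isConf_restrict_iff.1 hc).isInflation

/-- This keeps pushouts of inflations inside the subcategory without closure under extensions: a map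
from a projective to `Y'` is a sum of one through `Y` and one through `X`. -/
lemma annSubcategory_of_conf (hS : IsExactCategory S) {X Y Y' Z : C} {f : Y ⟶ Y'} {i : X ⟶ Y'}
    {p : Y' ⟶ Z} (hc : IsConf S i p) (hf : IsDeflation S (f ≫ p)) (hX : annSubcategory S T X)
    (hY : annSubcategory S T Y) : annSubcategory S T Y' := fun Q Q' a ha g => by
  obtain ⟨K, k, h⟩ := hf
  obtain ⟨h0, h⟩ := h
  obtain ⟨b, hb⟩ := ha.2.1 _ h (g ≫ p)
  obtain ⟨l, hl⟩ := hc.exists_lift hS (g - b ≫ f) (by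
    rw [Preadditive.sub_comp, Category.assoc]; exact sub_eq_zero.2 hb.symm)
  rw [show g = b ≫ f + l ≫ i by rw [hl]; abel, Preadditive.comp_add, ← Category.assoc,
    hY Q Q' a ha, ← Category.assoc, hX Q Q' a ha]
  simp

/-- The exact category attached to `T`. -/
lemma isExactCategory_ann (hS : IsExactCategory S) (T : ObjectProperty C) :
    IsExactCategory (annConflations S T) where
  additive := by
    have := hS.additive
    have : HasFiniteProducts (annSubcategory S T).FullSubcategory :=
      ⟨fun n => inferInstance⟩
    exact HasFiniteBiproducts.of_hasFiniteProducts
  iso_closed := by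
    have := hS.iso_closed
    exact ⟨fun e h => S.prop_of_iso ((annSubcategory S T).ι.mapShortComplex.mapIso e) h⟩
  isKernel K hK := by
    have hc : IsConf S K.f.hom K.g.hom := isConf_restrict_iff.1 ⟨K.zero, hK⟩
    have := hc.mono hS
    have : Mono K.f := (annSubcategory S T).ι.mono_of_mono_map ‹_›
    exact ⟨KernelFork.IsLimit.ofι' _ _ fun x hx =>
      ⟨ObjectProperty.homMk (hc.exists_lift hS x.hom (congrArg (·.hom) hx)).choose,
        ObjectProperty.hom_ext _ (hc.exists_lift hS x.hom (congrArg (·.hom) hx)).choose_spec⟩⟩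
  isCokernel K hK := by
    have hc : IsConf S K.f.hom K.g.hom := isConf_restrict_iff.1 ⟨K.zero, hK⟩
    have := hc.epi hS
    have : Epi K.g := (annSubcategory S T).ι.epi_of_epi_map ‹_›
    exact ⟨CokernelCofork.IsColimit.ofπ' _ _ fun x hx =>
      ⟨ObjectProperty.homMk (hc.exists_desc hS x.hom (congrArg (·.hom) hx)).choose,
        ObjectProperty.hom_ext _ (hc.exists_desc hS x.hom (congrArg (·.hom) hx)).choose_spec⟩⟩
  id_inflation X := isInflation_ann (hS.id_inflation X.obj)
  id_deflation X := isDeflation_ann hS (hS.id_deflation X.obj)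
  comp_inflation _ _ hi hj := isInflation_ann (hS.comp_inflation _ _ hi.hom hj.hom)
  comp_deflation _ _ hp hq := isDeflation_ann hS (hS.comp_deflation _ _ hp.hom hq.hom)
  pushout_inflation {X Y X'} i f hi := by
    obtain ⟨Z, p, hc⟩ := hi.hom
    have hc : IsConf S i.hom p := hc
    obtain ⟨Y', f', i', p', hpo, hc', e⟩ := hc.exists_pushout hS f.hom
    have hY' : annSubcategory S T Y' :=
      annSubcategory_of_conf hS hc' (e ▸ hc.isDeflation) X'.property Y.property
    refine ⟨⟨Y', hY'⟩, ObjectProperty.homMk f', ObjectProperty.homMk i', ?_,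
      isInflation_ann hc'.isInflation⟩
    exact IsPushout.of_map (annSubcategory S T).ι (ObjectProperty.hom_ext _ hpo.w) hpo
  pullback_deflation {Y Z Z'} p f hp := by
    obtain ⟨Y', f', p', hpb, hp'⟩ := hS.pullback_deflation p.hom f.hom hp.hom
    have hY' : annSubcategory S T Y' := fun Q Q' a ha g => by
      refine hpb.hom_ext ?_ ?_
      · rw [Category.assoc, Y.property Q Q' a ha, zero_comp]
      · rw [Category.assoc, Z'.property Q Q' a ha, zero_comp]
    refine ⟨⟨Y', hY'⟩, ObjectProperty.homMk f', ObjectProperty.homMk p', ?_,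
      isDeflation_ann hS hp'⟩
    exact IsPullback.of_map (annSubcategory S T).ι (ObjectProperty.hom_ext _ hpb.w) hpb

lemma Fac.obj {A : ObjectProperty C} {X : A.FullSubcategory}
    (hX : Fac (restrict S A) (T.inverseImage A.ι) X) : Fac S T X.obj := by
  obtain ⟨Y, p, hY, hp⟩ := hX
  exact ⟨Y.obj, p.hom, hY, hp.hom⟩

/-- `Fac` can only shrink in the subcategory, and by fullness an ambient retraction still splits the
conflation. -/
lemma isTauRigid_ann (hS : IsExactCategory S) (hT : IsTauRigid S T) :
    IsTauRigid (annConflations S T) (inAnn S T) where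
  additivelyClosed := hT.additivelyClosed.inverseImage_ι _
  ext_fac X Y hX hY := by
    refine (extVanishes_one_iff (isExactCategory_ann hS T)).2 fun i p hc => ?_
    obtain ⟨r, hr⟩ := hT.exists_retraction hS hX hY.obj (isConf_restrict_iff.1 hc)
    exact ⟨ObjectProperty.homMk r, ObjectProperty.hom_ext _ hr⟩

/-- If every projective object `P` admits an exact sequence `P → T₀ ↠ G` whose first map is a left
`T`-approximation, with `G` in `Q`, then every object `X` of the exact category attached to `T`
admits a conflation `X ↣ F ↠ G` with `F` in `Fac T` and `G` in `Q`. -/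
lemma embedsInFac_ann (hS : IsExactCategory S) (hP : HasEnoughProjectives S)
    (hC : WeaklyIdempotentComplete C) {Q : ObjectProperty C}
    (h : ∀ P : C, IsProjective S P → ∃ (K T₀ G : C) (d : P ⟶ K) (i : K ⟶ T₀) (g : T₀ ⟶ G),
      IsDeflation S d ∧ IsConf S i g ∧ IsLeftApproximation T (d ≫ i) ∧ Q G) :
    EmbedsInFac (annConflations S T) (inAnn S T) (Q.inverseImage (annSubcategory S T).ι) := by
  intro X
  obtain ⟨P, π, hPP, hπ⟩ := hP X.obj
  obtain ⟨K, T₀, G, d, i, g, hd, hig, hT₀, hG⟩ := h P hPP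
  obtain ⟨M, m, hmd⟩ := hd
  have hmd : IsConf S m d := hmd
  -- Any map from `P` to an object of `T` factors through `d`, so it vanishes on `M`. Hence `R ↠ M ⟶
  -- P` lies in the ideal and is killed by `π`.
  have hm : m ≫ π = 0 := by
    obtain ⟨R, ρ, hR, N, n, hnρ⟩ := hP M
    have := IsConf.epi (S := S) (i := n) hS hnρ
    rw [← cancel_epi ρ, comp_zero, ← Category.assoc]
    refine X.property R P (ρ ≫ m) ⟨hR, hPP, fun Y hY a => ?_⟩ π
    obtain ⟨b, rfl⟩ := hT₀.2 Y hY a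
    simp [reassoc_of% hmd.zero]
  obtain ⟨φ, rfl⟩ := hmd.exists_desc hS π hm
  obtain ⟨L, l, hl⟩ := isDeflation_of_comp hS hC hπ
  obtain ⟨F, f, j, q, hjq, hf, e1, e2⟩ := hig.exists_pushout_deflation hS hl
  have hAT₀ := le_annSubcategory S T _ hT₀.1
  have hAF : annSubcategory S T F := annSubcategory_of_deflation hf.isDeflation hAT₀
  have hAG : annSubcategory S T G := annSubcategory_of_deflation hig.isDeflation hAT₀
  exact ⟨⟨F, hAF⟩, ⟨G, hAG⟩, ObjectProperty.homMk j, ObjectProperty.homMk q,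
    isConf_restrict_iff.2 hjq, ⟨⟨T₀, hAT₀⟩, ObjectProperty.homMk f, hT₀.1,
      isDeflation_ann hS hf.isDeflation⟩, hG⟩

end AnnSubcategory

end QuillenExact

/-- Let `(C, S)` be a skeletally small, weakly idempotent complete exact category with enough
projectives, and let `T` be a `τ`-rigid subcategory with admissible left `T`-approximations of all
projectives.  Then the full subcategory of all `X` with `Hom(I, X) = 0` is an exact category, it
contains `T`, and `T` is partial tilting in it; if `T` is support `τ`-tilting, then `T` is tilting
in it. -/
theorem theorem4p4 {C : Type u} [Category.{v} C] [Preadditive C] [EssentiallySmall.{w} C]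
    (S : ObjectProperty (ShortComplex C)) (hS : QuillenExact.IsExactCategory S)
    (hP : QuillenExact.HasEnoughProjectives S)
    (hC : QuillenExact.WeaklyIdempotentComplete C)
    (T : ObjectProperty C) (hT : QuillenExact.IsTauRigid S T)
    (hA : QuillenExact.ConditionA S T) :
    QuillenExact.IsExactCategory (QuillenExact.annConflations S T) ∧
    T ≤ QuillenExact.annSubcategory S T ∧
    QuillenExact.IsPartialTilting (QuillenExact.annConflations S T)
      (QuillenExact.inAnn S T) ∧
    (QuillenExact.IsSupportTauTilting S T →
      QuillenExact.IsTilting (QuillenExact.annConflations S T) (QuillenExact.inAnn S T)) := by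
  have hE := QuillenExact.isExactCategory_ann hS T
  have hR := QuillenExact.isTauRigid_ann hS hT
  -- Condition (A) does not constrain the cokernel of the approximation; partial tilting needs only
  -- the embedding into `Fac T`.
  have hF : QuillenExact.EmbedsInFac (QuillenExact.annConflations S T)
      (QuillenExact.inAnn S T) (ObjectProperty.inverseImage ⊤ _) :=
    QuillenExact.embedsInFac_ann hS hP hC fun P hPP => by
      obtain ⟨X, f, hf, K, d, i, hd, ⟨G, g, hig⟩, rfl⟩ := hA P hPP
      exact ⟨K, X, G, d, i, g, hd, hig, hf, trivial⟩
  refine ⟨hE, QuillenExact.le_annSubcategory S T, hR.isPartialTilting hE hF,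
    fun hST => hR.isTilting hE (QuillenExact.embedsInFac_ann hS hP hC fun P hPP => ?_)⟩
  obtain ⟨K, T₀, T₁, d, i, g, h0, hT₀, hT₁, hd, hig, hf⟩ := hST.exact_seq P hPP
  exact ⟨K, T₀, T₁, d, i, g, hd, ⟨h0, hig⟩, hf, hT₁⟩
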